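/- Let $r\ge 3$ be an odd squarefree integer, let $\pi(r)$ be its set of prime divisors, let $m=|\pi(r)|$, and let $p_{\max}$ be the largest element of $\pi(r)$. Let $f\in\mathbb Z[x]$ be irreducible and nonconstant, with leading coefficient $\mathrm{lc}(f)$, and suppose that $f\ne\pm x$ and $f\neq\pm\Phi_y(x)$ for every $y\ge 1$, where $\Phi_y$ is the $y$-th cyclotomic polynomial. For a complex root $\alpha$ of $f$ put $K_\alpha=\mathbb Q(\alpha)(\zeta_p: p\in\pi(r))$, where $\zeta_p$ is a primitive $p$-th root of unity. Let $g_1,\dots,g_T\in\mathcal O_{K_\alpha}^\times$ be a fixed system of representatives of a basis of $\mathcal O_{K_\alpha}^\times$ modulo torsion, and for $u\in\mathcal O_{K_\alpha}^\times$ let $v_{g_k}(u)\in\mathbb Z$ be the exponents in $u=\zeta\prod_k g_k^{v_{g_k}(u)}$, with $\zeta$ a root of unity. Define $\Lambda^\star(f,\pi(r))\in\mathbb N_0\cup\{\infty\}$ to be the maximum over all complex roots $\alpha$ of $f$ of - $\displaystyle\sum_{\mathfrak p\mid\alpha\mathcal O_{K_\alpha}} v_{\mathfrak p}(\alpha\mathcal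 O_{K_\alpha})$ if $\alpha\neq0$ and $\alpha\notin\mathcal O_{K_\alpha}^\times$, the sum being over the nonzero primes $\mathfrak p$ with $v_{\mathfrak p}(\alpha\mathcal O_{K_\alpha})>0$ (here $\alpha\mathcal O_{K_\alpha}$ is an integral ideal if $\mathrm{lc}(f)=\pm1$, and a fractional ideal in general); - $\displaystyle\sum_{p\in\pi(r)}\ \min_{k:\,v_{g_k}(\alpha)\ne0} v_p\bigl(v_{g_k}(\alpha)\bigr)$ if $\alpha$ is a unit of $\mathcal O_{K_\alpha}$ of infinite order; - $\infty$ otherwise. Put $H=\left\lceil\log_{\frac{p_{\max}-1}{p_{\max}}}\left(\log_{|\mathrm{lc}(f)|}2\right)\right\rceil+1$ if $\mathrm{lc}(f)\ne\pm1$, and $$A(f,\pi(r))=\begin{cases} r^{\,H+m\Lambda^\star(f,\pi(r))}, & \mathrm{lc}(f)\neq\pm1,\\ r^{\,\Lambda^\star(f,\pi(r))}, & \mathrm{lc}(f)=\pm1.\end{cases}$$ Then $A(f,\pi(r))$ is finite and, for every integer $\lambda\ge0$, the polynomial $f(x^{r^\lambda})$ has at most $A(f,\pi(r))$ irreducible factors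 in $\mathbb Z[x]$, counted with multiplicity. Moreover, if $\mathrm{lc}(f)\ne\pm1$, then for every $\lambda\ge 0$ it has at most $r^{H}$ irreducible factors (so in this case the bound holds whatever value in $[0,\infty]$ is given to $\Lambda^\star$). -/

import Mathlib

open Polynomial NumberField
open scoped nonZeroDivisors

noncomputable section

/-- The field `ℚ(α)(ζ_p : p ∈ P)`, as a subfield of `ℂ`. -/
def cyclotomicAdjoin (P : Finset ℕ) (α : ℂ) : IntermediateField ℚ ℂ :=
  IntermediateField.adjoin ℚ (insert α (↑(P.biUnion fun p => primitiveRoots p ℂ) : Set ℂ))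

theorem mem_cyclotomicAdjoin (P : Finset ℕ) (α : ℂ) : α ∈ cyclotomicAdjoin P α :=
  IntermediateField.subset_adjoin ℚ _ (Set.mem_insert _ _)

theorem numberField_cyclotomicAdjoin (P : Finset ℕ) {α : ℂ} (hα : IsIntegral ℚ α) :
    NumberField (cyclotomicAdjoin P α) := by
  have hfin : FiniteDimensional ℚ (cyclotomicAdjoin P α) := by
    unfold cyclotomicAdjoin
    have : Finite ↥(insert α (↑(P.biUnion fun p => primitiveRoots p ℂ) : Set ℂ)) :=
      ((Finset.finite_toSet _).insert α).to_subtype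
    refine IntermediateField.finiteDimensional_adjoin fun x hx => ?_
    rcases Set.mem_insert_iff.1 hx with rfl | hx
    · exact hα
    · obtain ⟨p, -, hp⟩ := Finset.mem_biUnion.1 (Finset.mem_coe.1 hx)
      have h0 : 0 < p := by
        rcases Nat.eq_zero_or_pos p with rfl | h
        · simp at hp
        · exact h
      exact (((mem_primitiveRoots h0).1 hp).isIntegral h0).tower_top
  exact { to_charZero := inferInstance, to_finiteDimensional := hfin }

theorem isIntegral_of_mem_rootSet {f : ℤ[X]} {α : ℂ} (h : α ∈ f.rootSet ℂ) :
    IsIntegral ℚ α := by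
  obtain ⟨h0, hα⟩ := mem_rootSet'.1 h
  have h0' : f ≠ 0 := fun h => h0 (by simp [h])
  refine IsAlgebraic.isIntegral ⟨f.map (Int.castRingHom ℚ), ?_, ?_⟩
  · exact (Polynomial.map_ne_zero_iff Int.cast_injective).2 h0'
  · rw [aeval_def, eval₂_map, ← hα, aeval_def]
    congr 1

/-- The exponent `v_{g_k}(u)` of the `k`-th fundamental unit `g_k` in the unique expression
`u = ζ ∏ g_j ^ (e j)` of the unit `u`, with `ζ` a torsion unit and `g` a fixed fundamental system
of units of `K` (a basis of the units modulo torsion). -/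
def unitExponent (K : Type*) [Field K] [NumberField K] (u : (𝓞 K)ˣ)
    (k : Fin (Units.rank K)) : ℤ :=
  (Units.exist_unique_eq_mul_prod K u).choose.2 k

/-- The exponent of the prime `v` in the factorization of the fractional ideal `α 𝓞_K`
(equal to `0` when `α = 0`). -/
def primeExponent {K : Type*} [Field K] [NumberField K] (α : K)
    (v : IsDedekindDomain.HeightOneSpectrum (𝓞 K)) : ℤ :=
  FractionalIdeal.count K v (FractionalIdeal.spanSingleton (𝓞 K)⁰ α)

open Classical in
/-- The contribution of a single element `α` of a number field `K` to `Λ⋆`.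
* If `α` is a non-torsion unit of `𝓞_K`: the sum over `p ∈ P` of the least `p`-adic valuation of
  a nonzero exponent of `α` with respect to a basis of the units modulo torsion.
* If `α` is nonzero and is not a unit of `𝓞_K`: the sum of `v_𝔭(α 𝓞_K)` over the primes `𝔭` that
  divide `α 𝓞_K`, that is, those with `v_𝔭(α 𝓞_K) > 0`.
* Otherwise (`α` is zero or a root of unity): `∞`. -/
def lambdaTerm (K : Type*) [Field K] [NumberField K] (P : Finset ℕ) (α : K) : ℕ∞ :=
  if h : ∃ u : (𝓞 K)ˣ, ((u : 𝓞 K) : K) = α then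
    if h.choose ∈ Units.torsion K then ⊤
    else ∑ p ∈ P, ⨅ k : Fin (Units.rank K), ⨅ _ : unitExponent K h.choose k ≠ 0,
      (padicValInt p (unitExponent K h.choose k) : ℕ∞)
  else if α = 0 then ⊤
  else ((∑ᶠ v : IsDedekindDomain.HeightOneSpectrum (𝓞 K), (primeExponent α v).toNat : ℕ) : ℕ∞)

/-- `Λ⋆(f, P)`: the maximum of `lambdaTerm` over the complex roots `α` of `f`, each taken in the
number field `ℚ(α)(ζ_p : p ∈ P)`. -/
def LambdaStar (f : ℤ[X]) (P : Finset ℕ) : ℕ∞ :=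
  ⨆ α : f.rootSet ℂ,
    haveI := numberField_cyclotomicAdjoin P (isIntegral_of_mem_rootSet α.2)
    lambdaTerm (cyclotomicAdjoin P (α : ℂ)) P ⟨(α : ℂ), mem_cyclotomicAdjoin P α⟩

/-- `⌈log_{(p-1)/p} (log_{|lc f|} 2)⌉ + 1`, where `p` is the largest prime divisor of `r`.
For `r ≥ 3` odd and `|lc f| ≥ 2` the real number under the ceiling is nonnegative, so that its
natural-number ceiling is its ceiling. -/
def leadingExponent (f : ℤ[X]) (r : ℕ) : ℕ :=
  ⌈Real.logb ((((r.primeFactors.sup id : ℕ) : ℝ) - 1) / ((r.primeFactors.sup id : ℕ) : ℝ))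
    (Real.logb |(f.leadingCoeff : ℝ)| 2)⌉₊ + 1

/-- The bound `A(f, π(r))`, as an extended natural number. -/
def factorBound (f : ℤ[X]) (r : ℕ) : ℕ∞ :=
  if f.leadingCoeff = 1 ∨ f.leadingCoeff = -1 then
    (r : ℕ∞) ^ LambdaStar f r.primeFactors
  else
    (r : ℕ∞) ^ ((leadingExponent f r : ℕ∞) +
      (r.primeFactors.card : ℕ∞) * LambdaStar f r.primeFactors)

/-- The number of irreducible factors, counted with multiplicity, of a nonzero `g ∈ ℤ[x]`. -/
def numIrreducibleFactors (g : ℤ[X]) : ℕ :=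
  Multiset.card (UniqueFactorizationMonoid.factors g)

end

/-! Let `N = r ^ l`, let `q` be an irreducible factor of `f(x^N)`, `β` a root of `q` and `α = β ^
N`, a root of `f`. If `lc f = ±1`, then `α` is integral. With `n = [ℚ(β) : ℚ(α)]`, the relative norm
`γ` of `β` lies in `ℚ(α)` and satisfies `γ ^ N = α ^ n` (`exists_norm_pow_eq`). Comparing the
exponents of both sides at a prime or at a fundamental unit shows that `α` can be this close to an
`N`-th power only if `N ≤ n * r ^ Λ` (`pow_le_mul_pow_of_lambdaTerm_eq`). Hence `deg f(x^N) ≤ deg q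
* r ^ Λ` for every `q`, and since the degrees of the factors add up, there are at most `r ^ Λ` of
them. If `lc f ≠ ±1`, no factor has leading coefficient `±1`: otherwise `β`, hence `α`, would be
integral and `f` monic up to sign. So `s` factors force `2 ^ s ≤ |lc f|`, which gives `s ≤ r ^ H`
without any use of `Λ`. `Λ` is finite because `f` has finitely many roots, none of them zero or a
root of unity. -/

section LambdaTerm

variable {K : Type*} [Field K] [NumberField K]

/-! ### Unit exponents and prime exponents, and the size of `lambdaTerm`. -/

theorem exists_torsion_mul_prod_unitExponent (u : (𝓞 K)ˣ) :
    ∃ ζ : Units.torsion K, u = ζ * ∏ i, Units.fundSystem K i ^ unitExponent K u i :=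
  ⟨_, (Units.exist_unique_eq_mul_prod K u).choose_spec.1⟩

theorem unitExponent_eq {u : (𝓞 K)ˣ} (ζ : Units.torsion K) (e : Fin (Units.rank K) → ℤ)
    (h : u = ζ * ∏ i, Units.fundSystem K i ^ e i) : unitExponent K u = e :=
  congrArg Prod.snd ((Units.exist_unique_eq_mul_prod K u).choose_spec.2 (ζ, e) h).symm

theorem unitExponent_pow (u : (𝓞 K)ˣ) (n : ℕ) (k : Fin (Units.rank K)) :
    unitExponent K (u ^ n) k = n * unitExponent K u k := by
  obtain ⟨ζ, hζ⟩ := exists_torsion_mul_prod_unitExponent u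
  refine congrFun (unitExponent_eq (ζ ^ n) (fun i => n * unitExponent K u i) ?_) k
  conv_lhs => rw [hζ]
  rw [mul_pow, ← Finset.prod_pow]
  simp only [← zpow_natCast, ← zpow_mul, mul_comm, Subgroup.coe_zpow]

theorem exists_unitExponent_ne_zero {u : (𝓞 K)ˣ} (hu : u ∉ Units.torsion K) :
    ∃ k, unitExponent K u k ≠ 0 := by
  by_contra! h
  obtain ⟨ζ, hζ⟩ := exists_torsion_mul_prod_unitExponent u
  simp only [h, zpow_zero, Finset.prod_const_one, mul_one] at hζ
  exact hu (hζ ▸ ζ.2)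

theorem primeExponent_pow (α : K) (n : ℕ) (v : IsDedekindDomain.HeightOneSpectrum (𝓞 K)) :
    primeExponent (α ^ n) v = n * primeExponent α v := by
  rw [primeExponent, ← FractionalIdeal.spanSingleton_pow, FractionalIdeal.count_pow, primeExponent]

/-- A nonunit lies in some maximal ideal `M`; `count` reverses inclusions, so `(a) ≤ M` gives
exponent at least `1` at `M`. -/
theorem exists_primeExponent_pos {a : 𝓞 K} (ha : a ≠ 0) (hu : ¬ IsUnit a) :
    ∃ v, 0 < primeExponent (a : K) v := by
  obtain ⟨M, hM, haM⟩ := exists_max_ideal_of_mem_nonunits hu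
  have hM0 : M ≠ ⊥ := by
    rintro rfl
    exact ha ((Submodule.mem_bot _).1 haM)
  refine ⟨⟨M, hM.isPrime, hM0⟩, ?_⟩
  set v : IsDedekindDomain.HeightOneSpectrum (𝓞 K) := ⟨M, hM.isPrime, hM0⟩
  have h1 := FractionalIdeal.count_self K v
  have h2 : FractionalIdeal.count K v (v.asIdeal : FractionalIdeal (𝓞 K)⁰ K) ≤
      FractionalIdeal.count K v (FractionalIdeal.spanSingleton (𝓞 K)⁰ (a : K)) := by
    refine FractionalIdeal.count_mono K v ?_ ?_
    · rw [Ne, FractionalIdeal.spanSingleton_eq_zero_iff]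
      simpa using ha
    · rw [FractionalIdeal.spanSingleton_le_iff_mem]
      exact FractionalIdeal.mem_coeIdeal_of_mem _ haM
  unfold primeExponent
  omega

/-- Guards against the default value `0` that `finsum` takes on infinite support. -/
theorem finite_support_primeExponent_toNat (α : K) :
    (Function.support fun v => (primeExponent α v).toNat).Finite := by
  have h := FractionalIdeal.finite_factors (FractionalIdeal.spanSingleton (𝓞 K)⁰ α)
  rw [Filter.eventually_cofinite] at h
  refine h.subset fun v hv h0 => hv ?_
  change (FractionalIdeal.count K v _).toNat = 0
  rw [h0]; rfl

theorem primeExponent_le_finsum (α : K) (v : IsDedekindDomain.HeightOneSpectrum (𝓞 K)) :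
    primeExponent α v ≤ ((∑ᶠ w, (primeExponent α w).toNat : ℕ) : ℤ) := by
  have h := single_le_finsum v (finite_support_primeExponent_toNat α) fun _ => Nat.zero_le _
  have := Int.self_le_toNat (primeExponent α v)
  exact this.trans (by exact_mod_cast h)

theorem lambdaTerm_ne_top (P : Finset ℕ) {α : K} (h0 : α ≠ 0) (h1 : ∀ n : ℕ, 0 < n → α ^ n ≠ 1) :
    lambdaTerm K P α ≠ ⊤ := by
  unfold lambdaTerm
  split_ifs with h ht
  · exfalso
    obtain ⟨n, hn, hu⟩ := isOfFinOrder_iff_pow_eq_one.1 ((CommGroup.mem_torsion _).1 ht)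
    refine h1 n hn ?_
    rw [← h.choose_spec, ← map_pow, ← Units.val_pow_eq_pow_val, hu]
    simp
  · obtain ⟨k, hk⟩ := exists_unitExponent_ne_zero ht
    refine WithTop.sum_ne_top.2 ?_
    -- An infimum over no indices would be `⊤`; the nonzero exponent at `k` keeps it finite.
    exact fun p _ => ne_top_of_le_ne_top (ENat.natCast_ne_top _) (iInf₂_le k hk)
  · exact ENat.natCast_ne_top _

/-- Every prime of `B` divides `r`; replacing each such prime by `r` itself lets the exponents be
added. -/
theorem le_pow_of_forall_dvd {r l B : ℕ} (hr : r ≠ 0) (hB : B ∣ r ^ l) {c : ℕ → ℕ}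
    (hc : ∀ p ∈ r.primeFactors, B.factorization p ≤ c p) :
    B ≤ r ^ ∑ p ∈ r.primeFactors, c p := by
  have hB0 : B ≠ 0 := ne_zero_of_dvd_ne_zero (pow_ne_zero l hr) hB
  have hsub : B.primeFactors ⊆ r.primeFactors := fun p hp => by
    have hp' := Nat.prime_of_mem_primeFactors hp
    exact Nat.mem_primeFactors.2 ⟨hp',
      hp'.dvd_of_dvd_pow ((Nat.dvd_of_mem_primeFactors hp).trans hB), hr⟩
  calc B = ∏ p ∈ r.primeFactors, p ^ B.factorization p := by
        conv_lhs => rw [← Nat.prod_factorization_pow_eq_self hB0]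
        exact Finsupp.prod_of_support_subset _ hsub _ fun _ _ => pow_zero _
    _ ≤ ∏ p ∈ r.primeFactors, r ^ c p := by
        refine Finset.prod_le_prod' fun p hp => ?_
        exact (Nat.pow_le_pow_left (Nat.le_of_mem_primeFactors hp) _).trans
          (Nat.pow_le_pow_right (Nat.pos_of_ne_zero hr) (hc p hp))
    _ = _ := Finset.prod_pow_eq_pow_sum _ _ _

/-- Exponents are additive, so `γ ^ N = α ^ n` becomes `N * e(γ) = n * e(α)`. For a unit, `N /
gcd(N, n)` divides every exponent of `α`, which bounds it by `r ^ Λ`. For a nonunit, a prime with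
`v(α) > 0` has `v(γ) ≥ 1`, so `N ≤ n * v(α) ≤ n * Λ`. -/
theorem pow_le_mul_pow_of_lambdaTerm_eq {r l n Λ : ℕ} (hr : 2 ≤ r) {α γ : K} (hα : IsIntegral ℤ α)
    (hγ : γ ^ r ^ l = α ^ n) (hn : 0 < n) (hΛ : lambdaTerm K r.primeFactors α = Λ) :
    r ^ l ≤ n * r ^ Λ := by
  have hN : 0 < r ^ l := by positivity
  unfold lambdaTerm at hΛ
  split_ifs at hΛ with h ht h0
  · exact absurd hΛ.symm (ENat.natCast_ne_top _)
  · set u := h.choose with hu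
    have hux : ((u : 𝓞 K) : K) = α := h.choose_spec
    have hγi : IsIntegral ℤ γ := IsIntegral.of_pow hN (hγ ▸ hα.pow n)
    obtain ⟨g, rfl⟩ : ∃ g : 𝓞 K, (g : K) = γ := ⟨⟨γ, hγi⟩, rfl⟩
    have hgu : g ^ r ^ l = (u : 𝓞 K) ^ n := by
      apply RingOfIntegers.coe_injective
      rw [map_pow, map_pow, hγ]
      exact congrArg (· ^ n) hux.symm
    have hg : IsUnit g := (isUnit_pow_iff hN.ne').1 (hgu ▸ u.isUnit.pow n)
    obtain ⟨w, rfl⟩ := hg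
    have hwu : w ^ r ^ l = u ^ n := Units.ext (by simpa using hgu)
    have hexp (k) : ((r ^ l : ℕ) : ℤ) * unitExponent K w k = n * unitExponent K u k := by
      rw [← unitExponent_pow, hwu, unitExponent_pow]
    set d := Nat.gcd (r ^ l) n with hd
    have hd0 : 0 < d := Nat.gcd_pos_of_pos_left _ hN
    obtain ⟨B, hB⟩ : d ∣ r ^ l := Nat.gcd_dvd_left _ _
    obtain ⟨n', hn'⟩ : d ∣ n := Nat.gcd_dvd_right _ _
    have hcop : Nat.Coprime B n' := by
      have := Nat.coprime_div_gcd_div_gcd (m := r ^ l) (n := n) hd0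
      rwa [← hd, Nat.div_eq_of_eq_mul_right hd0 hB, Nat.div_eq_of_eq_mul_right hd0 hn'] at this
    have hdvd (k) : (B : ℤ) ∣ unitExponent K u k := by
      have h1 : (B : ℤ) * unitExponent K w k = n' * unitExponent K u k := by
        have h2 := hexp k
        rw [hB, hn'] at h2
        push_cast at h2
        rw [mul_assoc, mul_assoc] at h2
        exact mul_left_cancel₀ (by exact_mod_cast hd0.ne') h2
      exact (Int.isCoprime_iff_gcd_eq_one.2 (by simpa using hcop)).dvd_of_dvd_mul_left
        ⟨_, h1.symm⟩
    have hB0 : B ≠ 0 := by rintro rfl; simp at hB; omega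
    have hle : ∑ p ∈ r.primeFactors, B.factorization p ≤ Λ := by
      rw [← ENat.natCast_le_natCast, ← hΛ]
      push_cast
      refine Finset.sum_le_sum fun p hp => le_iInf₂ fun k hk => ?_
      have := Fact.mk (Nat.prime_of_mem_primeFactors hp)
      rw [ENat.natCast_le_natCast, padicValInt, ← padicValNat_dvd_iff_le (Int.natAbs_ne_zero.2 hk)]
      -- The `p`-part of `B` divides every nonzero exponent, in particular the one attaining the
      -- minimum.
      exact (Nat.ordProj_dvd B p).trans (Int.natCast_dvd.1 (hdvd k))
    calc r ^ l = d * B := hB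
      _ ≤ n * r ^ Λ := Nat.mul_le_mul (Nat.gcd_le_right _ hn)
        ((le_pow_of_forall_dvd (by omega) ⟨d, by rw [hB, mul_comm]⟩ fun p _ => le_rfl).trans
          (Nat.pow_le_pow_right (by omega) hle))
  · exact absurd hΛ.symm (ENat.natCast_ne_top _)
  · obtain ⟨a, rfl⟩ : ∃ a : 𝓞 K, (a : K) = α := ⟨⟨α, hα⟩, rfl⟩
    have ha : ¬ IsUnit a := fun hu => h ⟨hu.unit, rfl⟩
    obtain ⟨v, hv⟩ := exists_primeExponent_pos (by simpa using h0) ha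
    have hle := primeExponent_le_finsum (a : K) v
    rw [ENat.natCast_inj.1 hΛ] at hle
    have hexp : ((r ^ l : ℕ) : ℤ) * primeExponent γ v = n * primeExponent (a : K) v := by
      rw [← primeExponent_pow, hγ, primeExponent_pow]
    have hpos : 0 < primeExponent γ v := by
      have : 0 < (n : ℤ) * primeExponent (a : K) v := mul_pos (by exact_mod_cast hn) hv
      rw [← hexp] at this
      exact pos_of_mul_pos_right this (by positivity)
    have h1 : ((r ^ l : ℕ) : ℤ) ≤ ((n * Λ : ℕ) : ℤ) := by
      push_cast
      push_cast at hexp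
      calc ((r : ℤ) ^ l) ≤ r ^ l * primeExponent γ v := le_mul_of_one_le_right (by positivity) hpos
        _ = n * primeExponent (a : K) v := hexp
        _ ≤ n * Λ := by gcongr
    exact (by exact_mod_cast h1 : r ^ l ≤ n * Λ).trans
      (Nat.mul_le_mul_left _ (Nat.lt_pow_self (by omega)).le)

end LambdaTerm


/-! ### The relative norm of a root. -/

/-- Here `γ` is the norm of `β` from `F(β)` to `F(β ^ N)` and `n` is the degree of that extension:
`β ^ N` lies in the base, so its norm is its `n`-th power. The degree formula is the tower law. -/
theorem exists_norm_pow_eq {F C : Type*} [Field F] [Field C] [Algebra F C] {β : C}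
    (hβ : IsIntegral F β) (N : ℕ) :
    ∃ (n : ℕ) (γ : C), γ ∈ IntermediateField.adjoin F {β ^ N} ∧ γ ^ N = (β ^ N) ^ n ∧ 0 < n ∧
      (minpoly F β).natDegree = (minpoly F (β ^ N)).natDegree * n := by
  open IntermediateField in
  set L : IntermediateField F C := F⟮β⟯ with hL
  have : FiniteDimensional F L := adjoin.finiteDimensional hβ
  set b : L := AdjoinSimple.gen F β
  have hb : (b : C) = β := AdjoinSimple.coe_gen F β
  set E : IntermediateField F L := F⟮b ^ N⟯
  have hmap : E.map L.val = F⟮β ^ N⟯ := by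
    rw [adjoin_map, Set.image_singleton, map_pow]
    simp [hb]
  refine ⟨Module.finrank E L, ((Algebra.norm E b : E) : L), ?_, ?_, Module.finrank_pos, ?_⟩
  · rw [← hmap]
    exact ⟨_, (Algebra.norm E b).2, rfl⟩
  · have h : Algebra.norm E b ^ N = (AdjoinSimple.gen F (b ^ N)) ^ Module.finrank E L := by
      rw [← map_pow, ← Algebra.norm_algebraMap]
      rfl
    have h' := congrArg (fun x : E => ((x : L) : C)) h
    simpa [hb] using h'
  · have h1 := adjoin.finrank hβ
    have h2 : Module.finrank F E = (minpoly F (b ^ N)).natDegree :=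
      adjoin.finrank (IsIntegral.of_finite F _)
    have h3 : minpoly F (b ^ N) = minpoly F (β ^ N) := by
      rw [← minpoly.algebraMap_eq (algebraMap L C).injective (b ^ N)]
      congr 1
    rw [← h1, ← h3, ← h2, Module.finrank_mul_finrank]

/-! ### Irreducible integer polynomials and their roots. -/

theorem natDegree_minpoly_eq_of_irreducible {h : ℤ[X]} (hi : Irreducible h) (hd : 0 < h.natDegree)
    {β : ℂ} (hβ : aeval β h = 0) : (minpoly ℚ β).natDegree = h.natDegree := by
  have hi' : Irreducible (h.map (Int.castRingHom ℚ)) :=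
    (IsPrimitive.Int.irreducible_iff_irreducible_map_cast (hi.isPrimitive hd.ne')).1 hi
  have hβ' : aeval β (h.map (Int.castRingHom ℚ)) = 0 := by
    have := aeval_map_algebraMap ℚ β h
    rw [hβ] at this
    exact this
  rw [← minpoly.eq_of_irreducible hi' hβ', natDegree_mul_C (by simpa using hi'.ne_zero),
    natDegree_map_eq_of_injective Int.cast_injective]

theorem eq_or_eq_neg_of_dvd_of_irreducible {f g : ℤ[X]} (hf : Irreducible f) (hg : ¬ IsUnit g)
    (h : g ∣ f) : f = g ∨ f = -g := by
  obtain ⟨c, rfl⟩ := h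
  have hc : IsUnit c := (of_irreducible_mul hf).resolve_left hg
  obtain ⟨u, hu, rfl⟩ := Polynomial.isUnit_iff.1 hc
  rcases Int.isUnit_iff.1 hu with rfl | rfl <;> simp

theorem eq_minpoly_or_eq_neg_minpoly {f : ℤ[X]} (hf : Irreducible f) {α : ℂ}
    (hα : aeval α f = 0) (hi : IsIntegral ℤ α) : f = minpoly ℤ α ∨ f = -minpoly ℤ α :=
  eq_or_eq_neg_of_dvd_of_irreducible hf (minpoly.not_isUnit ℤ α)
    (minpoly.isIntegrallyClosed_dvd hi hα)

theorem root_ne_zero_of_ne_X {f : ℤ[X]} (hf : Irreducible f) (hX : f ≠ X ∧ f ≠ -X) {α : ℂ}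
    (hα : aeval α f = 0) : α ≠ 0 := by
  rintro rfl
  have h0 : f.coeff 0 = 0 := by
    rw [← map_zero (algebraMap ℤ ℂ), aeval_algebraMap_apply, ← coeff_zero_eq_aeval_zero] at hα
    simpa using hα
  have := eq_or_eq_neg_of_dvd_of_irreducible hf not_isUnit_X (X_dvd_iff.2 h0)
  tauto

theorem root_pow_ne_one_of_ne_cyclotomic {f : ℤ[X]} (hf : Irreducible f)
    (hcyc : ∀ y : ℕ, 0 < y → f ≠ cyclotomic y ℤ ∧ f ≠ -cyclotomic y ℤ) {α : ℂ}
    (hα : aeval α f = 0) (n : ℕ) (hn : 0 < n) : α ^ n ≠ 1 := by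
  intro h
  have hy : 0 < orderOf α := orderOf_pos_iff.2 (isOfFinOrder_iff_pow_eq_one.2 ⟨n, hn, h⟩)
  have hp : IsPrimitiveRoot α (orderOf α) := IsPrimitiveRoot.orderOf α
  have := eq_minpoly_or_eq_neg_minpoly hf hα (hp.isIntegral hy)
  rw [← cyclotomic_eq_minpoly hp hy] at this
  have := hcyc _ hy
  tauto

theorem isIntegral_of_leadingCoeff {f : ℤ[X]} {α : ℂ} (hα : aeval α f = 0)
    (h : f.leadingCoeff = 1 ∨ f.leadingCoeff = -1) : IsIntegral ℤ α := by
  rcases h with h | h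
  · exact ⟨f, h, hα⟩
  · exact ⟨-f, by rw [Monic, leadingCoeff_neg, h, neg_neg], by
      rw [← aeval_def, map_neg, hα, neg_zero]⟩

theorem natDegree_pos_of_irreducible_of_dvd {g h : ℤ[X]} (hg : g.IsPrimitive)
    (hh : Irreducible h) (hd : h ∣ g) : 0 < h.natDegree := by
  by_contra h0
  rw [eq_C_of_natDegree_eq_zero (Nat.eq_zero_of_not_pos h0)] at hh hd
  exact hh.not_isUnit ((hg _ hd).map C)

theorem isPrimitive_comp_X_pow {f : ℤ[X]} (hf : f.IsPrimitive) {N : ℕ} (hN : 0 < N) :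
    (f.comp (X ^ N)).IsPrimitive := by
  intro c hc
  rw [← expand_eq_comp_X_pow, C_dvd_iff_dvd_coeff] at hc
  refine hf c (C_dvd_iff_dvd_coeff _ _ |>.2 fun i => ?_)
  simpa [coeff_expand_mul hN] using hc (i * N)

theorem exists_aeval_eq_zero_of_natDegree_pos {h : ℤ[X]} (hd : 0 < h.natDegree) :
    ∃ β : ℂ, aeval β h = 0 :=
  IsAlgClosed.exists_aeval_eq_zero_of_injective ℂ Int.cast_injective h
    (natDegree_pos_iff_degree_pos.1 hd).ne'

theorem aeval_pow_eq_zero_of_dvd {f h : ℤ[X]} {N : ℕ} (hd : h ∣ f.comp (X ^ N)) {β : ℂ}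
    (hβ : aeval β h = 0) : aeval (β ^ N) f = 0 := by
  have := aeval_eq_zero_of_dvd_aeval_eq_zero hd hβ
  rwa [aeval_comp, map_pow, aeval_X] at this

/-! ### Counting factors by degree and by leading coefficient. -/

theorem numIrreducibleFactors_le_of_natDegree {g : ℤ[X]} (hg : 0 < g.natDegree) {A : ℕ}
    (h : ∀ q, Irreducible q → q ∣ g → g.natDegree ≤ q.natDegree * A) :
    numIrreducibleFactors g ≤ A := by
  have hg0 : g ≠ 0 := fun h0 => by simp [h0] at hg
  set s := UniqueFactorizationMonoid.factors g with hs
  have hprod : s.prod.natDegree = g.natDegree :=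
    natDegree_eq_of_degree_eq (degree_eq_degree_of_associated
      (UniqueFactorizationMonoid.factors_prod hg0))
  have h0 : (0 : ℤ[X]) ∉ s := fun h0 =>
    not_irreducible_zero (UniqueFactorizationMonoid.irreducible_of_factor _ h0)
  rw [natDegree_multiset_prod _ h0] at hprod
  have hle : (s.map fun _ => g.natDegree).sum ≤ (s.map fun q => q.natDegree * A).sum :=
    Multiset.sum_map_le_sum_map _ _ fun q hq =>
      h q (UniqueFactorizationMonoid.irreducible_of_factor q hq)
        (UniqueFactorizationMonoid.dvd_of_mem_factors hq)
  rw [Multiset.sum_map_mul_right, hprod, Multiset.map_const', Multiset.sum_replicate, smul_eq_mul,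
    mul_comm] at hle
  exact Nat.le_of_mul_le_mul_left hle hg

/-- `|lc|` is multiplicative, and each factor contributes at least `2`. -/
theorem two_pow_numIrreducibleFactors_le {g : ℤ[X]} (hg : g ≠ 0)
    (h : ∀ q, Irreducible q → q ∣ g → q.leadingCoeff ≠ 1 ∧ q.leadingCoeff ≠ -1) :
    2 ^ numIrreducibleFactors g ≤ g.leadingCoeff.natAbs := by
  set s := UniqueFactorizationMonoid.factors g with hs
  have hprod : s.prod.leadingCoeff.natAbs = g.leadingCoeff.natAbs := by
    rw [← Int.associated_iff_natAbs]
    exact (UniqueFactorizationMonoid.factors_prod hg).map leadingCoeffHom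
  rw [← hprod, leadingCoeff_multiset_prod, ← Int.natAbsHom_apply, map_multiset_prod,
    Multiset.map_map, numIrreducibleFactors, ← hs, ← Multiset.prod_replicate, ← Multiset.map_const']
  refine Multiset.prod_map_le_prod_map _ _ fun q hq => ?_
  have hi := UniqueFactorizationMonoid.irreducible_of_factor q hq
  have h1 := h q hi (UniqueFactorizationMonoid.dvd_of_mem_factors hq)
  have h2 := leadingCoeff_ne_zero.2 hi.ne_zero
  change 2 ≤ q.leadingCoeff.natAbs
  omega

theorem le_pow_leadingExponent {r : ℕ} (hr : 3 ≤ r) {f : ℤ[X]} {s : ℕ}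
    (hf : 2 ≤ f.leadingCoeff.natAbs) (hs : 2 ^ s ≤ f.leadingCoeff.natAbs) :
    s ≤ r ^ leadingExponent f r := by
  unfold leadingExponent
  obtain ⟨q, hq, hqp⟩ : ∃ q ∈ r.primeFactors, r.primeFactors.sup id = q :=
    Finset.exists_mem_eq_sup _ (Nat.nonempty_primeFactors.2 (by omega)) id
  rw [hqp]
  have hq2 : 2 ≤ q := (Nat.prime_of_mem_primeFactors hq).two_le
  have hqr : q ≤ r := Nat.le_of_mem_primeFactors hq
  have hL : |(f.leadingCoeff : ℝ)| = (f.leadingCoeff.natAbs : ℝ) := by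
    rw [Nat.cast_natAbs, Int.cast_abs]
  rw [hL]
  set L : ℝ := (f.leadingCoeff.natAbs : ℝ) with hLdef
  have hL2 : 2 ≤ L := by rw [hLdef]; exact_mod_cast hf
  have hq2' : (2 : ℝ) ≤ q := by exact_mod_cast hq2
  set b : ℝ := ((q : ℝ) - 1) / q with hb
  have hb0 : 0 < b := div_pos (by linarith) (by linarith)
  have hb1 : b < 1 := (div_lt_one (by linarith)).2 (by linarith)
  set y := Real.logb L 2 with hy
  have hy0 : 0 < y := Real.logb_pos (by linarith) (by norm_num)
  set H := ⌈Real.logb b y⌉₊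
  -- As `0 < b < 1`, powers of `b` decrease, so rounding the exponent up only lowers them. This
  -- holds also if the natural-number ceiling truncates to `0`.
  have h1 : b ^ H ≤ y := by
    calc b ^ H = b ^ (H : ℝ) := (Real.rpow_natCast _ _).symm
      _ ≤ b ^ Real.logb b y :=
        Real.rpow_le_rpow_of_exponent_ge hb0 hb1.le (Nat.le_ceil _)
      _ = y := Real.rpow_logb hb0 hb1.ne hy0
  have h2 : (s : ℝ) * y ≤ 1 := by
    have h3 : Real.logb L (2 ^ s) ≤ Real.logb L L :=
      Real.logb_le_logb_of_le (by linarith) (by positivity) (by rw [hLdef]; exact_mod_cast hs)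
    rwa [Real.logb_pow, Real.logb_self_eq_one (by linarith)] at h3
  -- `r * b ≥ q * b = q - 1 ≥ 1`.
  have h4 : 1 ≤ r * b := by
    have hrq : (q : ℝ) ≤ r := by exact_mod_cast hqr
    have : (q : ℝ) * b = q - 1 := by rw [hb]; field_simp
    nlinarith
  have h5 : (s : ℝ) ≤ r ^ H := by
    have h6 : (s : ℝ) * b ^ H ≤ r ^ H * b ^ H := by
      calc (s : ℝ) * b ^ H ≤ s * y := by gcongr
        _ ≤ 1 := h2
        _ ≤ (r * b) ^ H := one_le_pow₀ h4
        _ = r ^ H * b ^ H := mul_pow _ _ _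
    exact le_of_mul_le_mul_right h6 (by positivity)
  calc s ≤ r ^ H := by exact_mod_cast h5
    -- The final `+ 1` in `leadingExponent` is slack.
    _ ≤ r ^ (H + 1) := Nat.pow_le_pow_right (by omega) (by omega)

/-! ### Finiteness of `LambdaStar` and the two cases of the bound. -/

theorem lambdaTerm_le_LambdaStar {f : ℤ[X]} (P : Finset ℕ) {α : ℂ} (hα : α ∈ f.rootSet ℂ) :
    haveI := numberField_cyclotomicAdjoin P (isIntegral_of_mem_rootSet hα)
    lambdaTerm (cyclotomicAdjoin P α) P ⟨α, mem_cyclotomicAdjoin P α⟩ ≤ LambdaStar f P :=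
  le_iSup (fun α : f.rootSet ℂ =>
    haveI := numberField_cyclotomicAdjoin P (isIntegral_of_mem_rootSet α.2)
    lambdaTerm (cyclotomicAdjoin P (α : ℂ)) P ⟨(α : ℂ), mem_cyclotomicAdjoin P α⟩) ⟨α, hα⟩

theorem LambdaStar_ne_top {f : ℤ[X]} (P : Finset ℕ) (h0 : ∀ α : ℂ, aeval α f = 0 → α ≠ 0)
    (h1 : ∀ α : ℂ, aeval α f = 0 → ∀ n : ℕ, 0 < n → α ^ n ≠ 1) : LambdaStar f P ≠ ⊤ := by
  unfold LambdaStar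
  have : Finite (f.rootSet ℂ) := (f.rootSet_finite ℂ).to_subtype
  rcases isEmpty_or_nonempty (f.rootSet ℂ) with h | h
  · simp
  · obtain ⟨α, hα⟩ := exists_eq_ciSup_of_finite (f := fun α : f.rootSet ℂ =>
      haveI := numberField_cyclotomicAdjoin P (isIntegral_of_mem_rootSet α.2)
      lambdaTerm (cyclotomicAdjoin P (α : ℂ)) P ⟨(α : ℂ), mem_cyclotomicAdjoin P α⟩)
    rw [← hα]
    have hroot : aeval (α : ℂ) f = 0 := (mem_rootSet'.1 α.2).2
    have := numberField_cyclotomicAdjoin P (isIntegral_of_mem_rootSet α.2)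
    refine lambdaTerm_ne_top P (fun h => h0 _ hroot (congrArg Subtype.val h)) fun n hn h => ?_
    exact h1 _ hroot n hn (congrArg Subtype.val h)

theorem natDegree_comp_X_pow_le_of_dvd {r l Λ : ℕ} (hr : 2 ≤ r) {f q : ℤ[X]} (hf : Irreducible f)
    (hd : 0 < f.natDegree) (hlc : f.leadingCoeff = 1 ∨ f.leadingCoeff = -1)
    (hΛ : LambdaStar f r.primeFactors = Λ) (hq : Irreducible q) (hqf : q ∣ f.comp (X ^ r ^ l)) :
    (f.comp (X ^ r ^ l)).natDegree ≤ q.natDegree * r ^ Λ := by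
  have hN : 0 < r ^ l := by positivity
  have hqd := natDegree_pos_of_irreducible_of_dvd
    (isPrimitive_comp_X_pow (hf.isPrimitive hd.ne') hN) hq hqf
  obtain ⟨β, hβ⟩ := exists_aeval_eq_zero_of_natDegree_pos hqd
  have hα := aeval_pow_eq_zero_of_dvd hqf hβ
  have hint : IsIntegral ℤ (β ^ r ^ l) := isIntegral_of_leadingCoeff hα hlc
  have hβi : IsIntegral ℚ β := (IsIntegral.of_pow hN hint).tower_top
  obtain ⟨n, γ, hγm, hγ, hn, hdeg⟩ := exists_norm_pow_eq hβi (r ^ l)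
  rw [natDegree_minpoly_eq_of_irreducible hq hqd hβ,
    natDegree_minpoly_eq_of_irreducible hf hd hα] at hdeg
  have hroot : β ^ r ^ l ∈ f.rootSet ℂ := mem_rootSet.2 ⟨hf.ne_zero, hα⟩
  have hle := lambdaTerm_le_LambdaStar r.primeFactors hroot
  have := numberField_cyclotomicAdjoin r.primeFactors (isIntegral_of_mem_rootSet hroot)
  rw [hΛ] at hle
  obtain ⟨m, hm⟩ := ENat.ne_top_iff_exists.1 (ne_top_of_le_ne_top (ENat.natCast_ne_top _) hle)
  -- The norm lies in `ℚ(α)`, hence in the larger field in which `lambdaTerm` is computed.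
  have hγK : γ ∈ cyclotomicAdjoin r.primeFactors (β ^ r ^ l) :=
    (IntermediateField.adjoin_simple_le_iff.2 (mem_cyclotomicAdjoin _ _)) hγm
  have key := pow_le_mul_pow_of_lambdaTerm_eq (l := l) (γ := ⟨γ, hγK⟩) hr
    ((isIntegral_algHom_iff (cyclotomicAdjoin r.primeFactors (β ^ r ^ l)).val.toIntAlgHom
      Subtype.val_injective).1 hint) (Subtype.ext hγ) hn hm.symm
  rw [← hm, ENat.natCast_le_natCast] at hle
  rw [natDegree_comp, natDegree_X_pow, hdeg, mul_assoc]
  exact Nat.mul_le_mul_left _ (key.trans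
    (Nat.mul_le_mul_left _ (Nat.pow_le_pow_right (by omega) hle)))

/-- A factor with leading coefficient `±1` has an integral root `β`; then `β ^ N` is an integral
root of `f`, so `f` is, up to sign, its monic minimal polynomial over `ℤ`. -/
theorem leadingCoeff_ne_of_dvd_comp {f q : ℤ[X]} {N : ℕ} (hN : 0 < N) (hf : Irreducible f)
    (hd : 0 < f.natDegree) (h1 : f.leadingCoeff ≠ 1) (h2 : f.leadingCoeff ≠ -1)
    (hq : Irreducible q) (hqf : q ∣ f.comp (X ^ N)) :
    q.leadingCoeff ≠ 1 ∧ q.leadingCoeff ≠ -1 := by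
  by_contra! hc
  have hqd := natDegree_pos_of_irreducible_of_dvd
    (isPrimitive_comp_X_pow (hf.isPrimitive hd.ne') hN) hq hqf
  obtain ⟨β, hβ⟩ := exists_aeval_eq_zero_of_natDegree_pos hqd
  have hβi : IsIntegral ℤ β := isIntegral_of_leadingCoeff hβ (by tauto)
  have hm : (minpoly ℤ (β ^ N)).leadingCoeff = 1 := minpoly.monic (hβi.pow N)
  rcases eq_minpoly_or_eq_neg_minpoly hf (aeval_pow_eq_zero_of_dvd hqf hβ) (hβi.pow N) with h | h
  · exact h1 (h ▸ hm)
  · exact h2 (by rw [h, leadingCoeff_neg, hm])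

theorem numIrreducibleFactors_le_pow_leadingExponent {r N : ℕ} (hr : 3 ≤ r) (hN : 0 < N)
    {f : ℤ[X]} (hf : Irreducible f) (hd : 0 < f.natDegree) (h1 : f.leadingCoeff ≠ 1)
    (h2 : f.leadingCoeff ≠ -1) :
    numIrreducibleFactors (f.comp (X ^ N)) ≤ r ^ leadingExponent f r := by
  have hlc : (f.comp (X ^ N)).leadingCoeff = f.leadingCoeff := by
    rw [leadingCoeff_comp (by simpa using hN.ne'), leadingCoeff_X_pow, one_pow, mul_one]
  have h0 := leadingCoeff_ne_zero.2 hf.ne_zero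
  refine le_pow_leadingExponent hr (by omega) ?_
  rw [← hlc]
  exact two_pow_numIrreducibleFactors_le (leadingCoeff_ne_zero.1 (hlc ▸ h0)) fun q hq hqf =>
    leadingCoeff_ne_of_dvd_comp hN hf hd h1 h2 hq hqf

theorem mainTheorem2 (r : ℕ) (hr : 3 ≤ r) (hodd : Odd r) (hsq : Squarefree r)
    (f : ℤ[X]) (hirr : Irreducible f) (hdeg : 0 < f.natDegree)
    (hX : f ≠ X ∧ f ≠ -X)
    (hcyc : ∀ y : ℕ, 0 < y → f ≠ cyclotomic y ℤ ∧ f ≠ -cyclotomic y ℤ) :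
    factorBound f r ≠ ⊤ ∧
    (∀ l : ℕ, (numIrreducibleFactors (f.comp (X ^ (r ^ l))) : ℕ∞) ≤ factorBound f r) ∧
    (f.leadingCoeff ≠ 1 → f.leadingCoeff ≠ -1 →
      ∀ l : ℕ, numIrreducibleFactors (f.comp (X ^ (r ^ l))) ≤ r ^ leadingExponent f r) := by
  have hN (l : ℕ) : 0 < r ^ l := by positivity
  obtain ⟨Λ, hΛ⟩ := ENat.ne_top_iff_exists.1 (LambdaStar_ne_top r.primeFactors
    (fun α hα => root_ne_zero_of_ne_X hirr hX hα)
    (fun α hα => root_pow_ne_one_of_ne_cyclotomic hirr hcyc hα))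
  refine ⟨?_, fun l => ?_, fun h1 h2 l =>
    numIrreducibleFactors_le_pow_leadingExponent hr (hN l) hirr hdeg h1 h2⟩
  · unfold factorBound
    rw [← hΛ]
    split_ifs
    · exact_mod_cast ENat.natCast_ne_top (r ^ Λ)
    · exact_mod_cast ENat.natCast_ne_top (r ^ (leadingExponent f r + r.primeFactors.card * Λ))
  · unfold factorBound
    rw [← hΛ]
    split_ifs with hlc
    · have := numIrreducibleFactors_le_of_natDegree (g := f.comp (X ^ r ^ l)) (A := r ^ Λ)
        (by rw [natDegree_comp, natDegree_X_pow]; exact Nat.mul_pos hdeg (hN l))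
        fun q hq hqf => natDegree_comp_X_pow_le_of_dvd (by omega) hirr hdeg hlc hΛ.symm hq hqf
      exact_mod_cast this
    · push Not at hlc
      -- The summand with `Λ` only enlarges the exponent; `r ^ H` already bounds the count.
      have := (numIrreducibleFactors_le_pow_leadingExponent hr (hN l) hirr hdeg hlc.1 hlc.2).trans
        (Nat.pow_le_pow_right (by omega) (Nat.le_add_right _ (r.primeFactors.card * Λ)))
      exact_mod_cast this
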